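/- The (undirected) power graph $\mathcal{P}(G)$ of a finite group $G$ is the simple graph with vertex set $G$ in which two distinct elements $g,h\in G$ are adjacent if and only if $h\in\langle g\rangle$ or $g\in\langle h\rangle$, that is, one of them is a positive power of the other. Let $E(G)$ denote its set of (undirected) edges. **Theorem 1.3.** Let $n\ge 1$ be an integer and let $G$ be a finite group of order $n$. Then $$|E(G)|\le |E(\mathbb{Z}_n)|,$$ where $\mathbb{Z}_n$ is the cyclic group of order $n$; moreover, equality holds if and only if $G$ is cyclic. -/

import Mathlib

/-- The (undirected) power graph of a group `G`: the vertices are the elements of `G`, and two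
distinct elements are adjacent iff one of them lies in the cyclic subgroup generated by the other
(for finite `G`: iff one of them is a positive power of the other). -/
def powerGraph (G : Type*) [Group G] : SimpleGraph G where
  Adj g h := g ≠ h ∧ (h ∈ Subgroup.zpowers g ∨ g ∈ Subgroup.zpowers h)
  symm := ⟨fun _ _ hgh => ⟨hgh.1.symm, hgh.2.symm⟩⟩
  loopless := ⟨fun _ hg => hg.1 rfl⟩

open Finset

/-! Counting edges at each vertex turns twice the edge count plus the group order into the sum of `2
* o - φ o` over element orders `o`. `isCyclic_of_weighted_sum_le` treats all weights `a * o - b * φ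
o` with `0 < 2 * b ≤ a`, by induction on the order `n`. Let `p` be the largest prime factor of `n`.
If the sum reaches the cyclic value, averaging gives an element of order above `n / p`
(`exists_card_lt_mul_orderOf`), so the Sylow `p`-subgroup `P` is normal and cyclic
(`exists_normal_cyclic_sylow`). Summing over cosets of `P` bounds the sum by one of the same shape
over `G ⧸ P`, with new `a` and `b` (`sum_coset_weight`); hence the freedom in the weights. By
induction `G ⧸ P` is cyclic, equality holds on every coset, and a generating coset contains an
element of order `n`. -/

/-! ### Arithmetic of the cyclic sums -/

/-- The sum of the element orders of a cyclic group of order `n`. -/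
def cyclicOrderSum (n : ℕ) : ℕ := ∑ d ∈ n.divisors, d.totient * d

/-- The sum of the totients of the element orders of a cyclic group of order `n`. -/
def cyclicTotientSum (n : ℕ) : ℕ := ∑ d ∈ n.divisors, d.totient * d.totient

theorem sum_divisors_mul_of_coprime {f : ℕ → ℕ} (h0 : f 0 = 0) (h1 : f 1 = 1)
    (hf : ∀ {m n : ℕ}, m.Coprime n → f (m * n) = f m * f n) {m n : ℕ} (h : m.Coprime n) :
    ∑ d ∈ (m * n).divisors, f d = (∑ d ∈ m.divisors, f d) * ∑ d ∈ n.divisors, f d := by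
  let F : ArithmeticFunction ℕ := ⟨f, h0⟩
  have hF : F.IsMultiplicative := ⟨h1, hf⟩
  have := (hF.mul ArithmeticFunction.isMultiplicative_zeta).map_mul_of_coprime h
  simp only [ArithmeticFunction.mul_zeta_apply] at this
  exact this

theorem cyclicOrderSum_mul {m n : ℕ} (h : m.Coprime n) :
    cyclicOrderSum (m * n) = cyclicOrderSum m * cyclicOrderSum n :=
  sum_divisors_mul_of_coprime (by simp) (by simp)
    (fun h => by rw [Nat.totient_mul h]; ring) h

theorem cyclicTotientSum_mul {m n : ℕ} (h : m.Coprime n) :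
    cyclicTotientSum (m * n) = cyclicTotientSum m * cyclicTotientSum n :=
  sum_divisors_mul_of_coprime (by simp) (by simp)
    (fun h => by rw [Nat.totient_mul h]; ring) h

theorem cyclicTotientSum_le (n : ℕ) : cyclicTotientSum n ≤ cyclicOrderSum n :=
  Finset.sum_le_sum fun d _ => Nat.mul_le_mul_left _ d.totient_le

theorem cyclicTotientSum_pos {n : ℕ} (hn : n ≠ 0) : 0 < cyclicTotientSum n :=
  Finset.sum_pos (fun d hd => by
    have := Nat.totient_pos.2 (Nat.pos_of_mem_divisors hd)
    positivity) ⟨1, by simp [hn]⟩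

theorem cyclicOrderSum_prime_pow {p : ℕ} (hp : p.Prime) (k : ℕ) :
    ((p : ℤ) + 1) * cyclicOrderSum (p ^ k) = p * (p ^ k) ^ 2 + 1 := by
  obtain ⟨q, rfl⟩ : ∃ q, p = q + 1 := ⟨p - 1, by have := hp.pos; lia⟩
  induction k with
  | zero => simp [cyclicOrderSum]
  | succ k ih =>
    unfold cyclicOrderSum at ih ⊢
    rw [Nat.sum_divisors_prime_pow hp] at ih ⊢
    rw [sum_range_succ, Nat.totient_prime_pow_succ hp]
    push_cast [mul_add] at ih ⊢
    rw [ih]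
    ring

theorem cyclicTotientSum_prime_pow {p : ℕ} (hp : p.Prime) (k : ℕ) :
    ((p : ℤ) + 1) * cyclicTotientSum (p ^ k) = (p - 1) * (p ^ k) ^ 2 + 2 := by
  obtain ⟨q, rfl⟩ : ∃ q, p = q + 1 := ⟨p - 1, by have := hp.pos; lia⟩
  induction k with
  | zero => simp [cyclicTotientSum]; ring
  | succ k ih =>
    unfold cyclicTotientSum at ih ⊢
    rw [Nat.sum_divisors_prime_pow hp] at ih ⊢
    rw [sum_range_succ, Nat.totient_prime_pow_succ hp]
    push_cast [mul_add] at ih ⊢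
    rw [ih]
    simp
    ring

/-- For a prime power `q ^ k`, the two sums divided by `q ^ (2 * k)` exceed `q / (q + 1)` and `(q -
1) / (q + 1)`. The constants are the telescoped products of these ratios over all integers from 2 to
`P + 1`, as if each were prime. The second bound needs the first in its induction step. -/
theorem cyclic_sums_lower_bound (P : ℕ) : ∀ n : ℕ, n ≠ 0 → (∀ q, q.Prime → q ∣ n → q ≤ P + 1) →
    2 * (n : ℤ) ^ 2 ≤ (P + 2) * cyclicOrderSum n ∧
    (4 * P + 2) * (n : ℤ) ^ 2 ≤
      (P + 1) * (P + 2) * (2 * cyclicOrderSum n - cyclicTotientSum n) := by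
  induction P with
  | zero =>
    intro n hn h
    have : n = 1 := by
      by_contra h1
      obtain ⟨q, hq, hqn⟩ := Nat.exists_prime_and_dvd h1
      have := h q hq hqn
      have := hq.two_le
      lia
    subst this
    simp [cyclicOrderSum, cyclicTotientSum]
  | succ P ih =>
    intro n hn h
    by_cases hq : (P + 2).Prime
    · obtain ⟨k, m, hm, rfl⟩ := Nat.exists_eq_pow_mul_and_not_dvd hn (P + 2) hq.ne_one
      have hm0 : m ≠ 0 := by rintro rfl; simp at hm
      have hcop : ((P + 2) ^ k).Coprime m :=
        Nat.Coprime.pow_left k ((Nat.Prime.coprime_iff_not_dvd hq).2 hm)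
      obtain ⟨h1, h2⟩ := ih m hm0 fun q hqp hqm => by
        have h3 := h q hqp (hqm.mul_left _)
        have : q ≠ P + 2 := by rintro rfl; exact hm hqm
        lia
      have h3 := cyclicOrderSum_prime_pow hq k
      have h4 := cyclicTotientSum_prime_pow hq k
      have h5 : (cyclicTotientSum m : ℤ) ≤ cyclicOrderSum m := mod_cast cyclicTotientSum_le m
      rw [cyclicOrderSum_mul hcop, cyclicTotientSum_mul hcop]
      push_cast at h3 h4 ⊢
      generalize (cyclicOrderSum ((P + 2) ^ k) : ℤ) = A at *
      generalize (cyclicTotientSum ((P + 2) ^ k) : ℤ) = B at *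
      generalize hQ : ((P : ℤ) + 2) ^ k = Q at *
      have hx : (0 : ℤ) ≤ cyclicOrderSum m := by positivity
      generalize (cyclicOrderSum m : ℤ) = x at *
      generalize (cyclicTotientSum m : ℤ) = y at *
      have hP : (0 : ℤ) ≤ P := by positivity
      generalize (P : ℤ) = r at *
      have hQ0 : 0 ≤ Q ^ 2 := by positivity
      constructor
      · calc 2 * (Q * m) ^ 2 = Q ^ 2 * (2 * (m : ℤ) ^ 2) := by ring
          _ ≤ Q ^ 2 * ((r + 2) * x) := by gcongr
          _ ≤ Q ^ 2 * ((r + 2) * x) + x := by linarith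
          _ = ((r + 2) * Q ^ 2 + 1) * x := by ring
          _ = (r + 1 + 2) * (A * x) := by rw [← h3]; ring
      · calc (4 * (r + 1) + 2) * (Q * m) ^ 2
            = Q ^ 2 * ((4 * r + 2) * (m : ℤ) ^ 2 + 2 * (2 * (m : ℤ) ^ 2)) := by ring
          _ ≤ Q ^ 2 * ((r + 1) * (r + 2) * (2 * x - y) + 2 * ((r + 2) * x)) := by gcongr
          _ ≤ Q ^ 2 * ((r + 1) * (r + 2) * (2 * x - y) + 2 * ((r + 2) * x))
              + 2 * ((r + 2) * (x - y)) := by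
                have : 0 ≤ (r + 2) * (x - y) := mul_nonneg (by linarith) (by linarith)
                linarith
          _ = (r + 2) * (2 * (((r + 2) * Q ^ 2 + 1) * x) -
                ((r + 2 - 1) * Q ^ 2 + 2) * y) := by ring
          _ = (r + 1 + 1) * (r + 1 + 2) * (2 * (A * x) - B * y) := by rw [← h3, ← h4]; ring
    · obtain ⟨h1, h2⟩ := ih n hn fun q hqp hqn => by
        have h3 := h q hqp hqn
        have : q ≠ P + 2 := by rintro rfl; exact hq hqp
        lia
      have h5 : (cyclicTotientSum n : ℤ) ≤ cyclicOrderSum n := mod_cast cyclicTotientSum_le n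
      have hP : (0 : ℤ) ≤ P := by positivity
      have h6 : (0 : ℤ) ≤ (P + 2) * (cyclicOrderSum n - cyclicTotientSum n) :=
        mul_nonneg (by linarith) (by linarith)
      push_cast
      constructor <;> linarith

/-- The average of `2 * orderOf x - φ (orderOf x)` over a cyclic group of order `n` is at least
`2 * n / p` when `p` bounds the prime factors of `n`. -/
theorem two_mul_sq_le_of_forall_prime_le {n p : ℕ} (hn : n ≠ 0) (hp : 2 ≤ p)
    (h : ∀ q, q.Prime → q ∣ n → q ≤ p) :
    2 * (n : ℤ) ^ 2 ≤ p * (2 * cyclicOrderSum n - cyclicTotientSum n) := by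
  obtain ⟨r, rfl⟩ : ∃ r, p = r + 2 := ⟨p - 2, by lia⟩
  have h1 := (cyclic_sums_lower_bound (r + 1) n hn h).2
  push_cast at h1 ⊢
  have h2 : (0 : ℤ) ≤ r * n ^ 2 := by positivity
  refine le_of_mul_le_mul_left (a := (r : ℤ) + 3) ?_ (by positivity)
  linarith

/-! ### Weighted sums over cyclic groups -/

theorem sum_orderOf_of_isCyclic {G : Type*} [Group G] [Fintype G] [IsCyclic G] (f : ℕ → ℤ) :
    ∑ g : G, f (orderOf g) = ∑ d ∈ (Nat.card G).divisors, (d.totient : ℤ) * f d := by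
  classical
  rw [← Finset.sum_fiberwise_of_maps_to (t := (Nat.card G).divisors) (g := fun g : G => orderOf g)
    (fun g _ => Nat.mem_divisors.2 ⟨orderOf_dvd_natCard g, Nat.card_pos.ne'⟩)]
  refine Finset.sum_congr rfl fun d hd => ?_
  rw [Finset.sum_congr rfl (g := fun _ => f d) (by simp +contextual), Finset.sum_const,
    IsCyclic.card_orderOf_eq_totient (by rw [← Nat.card_eq_fintype_card]; exact Nat.dvd_of_mem_divisors hd)]
  simp

theorem sum_weight_mul_orderOf_of_isCyclic {G : Type*} [Group G] [Fintype G] [IsCyclic G]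
    {m : ℕ} (hm : m.Coprime (Nat.card G)) (a b : ℤ) :
    ∑ g : G, (a * (m * orderOf g : ℕ) - b * (m * orderOf g).totient) =
      a * cyclicOrderSum (Nat.card G) * m - b * cyclicTotientSum (Nat.card G) * m.totient := by
  have h : ∀ g : G, a * (m * orderOf g : ℕ) - b * (m * orderOf g).totient =
      a * m * orderOf g - b * m.totient * (orderOf g).totient := fun g => by
    rw [Nat.totient_mul (hm.coprime_dvd_right (orderOf_dvd_natCard g))]
    push_cast
    ring
  simp_rw [h]
  rw [sum_orderOf_of_isCyclic (fun d => a * m * d - b * m.totient * d.totient),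
    cyclicOrderSum, cyclicTotientSum]
  push_cast
  simp only [mul_sub, Finset.sum_sub_distrib, Finset.mul_sum, Finset.sum_mul]
  congr 1 <;> exact Finset.sum_congr rfl fun d _ => by ring

theorem sum_orderOf_weight_of_isCyclic {G : Type*} [Group G] [Fintype G] [IsCyclic G] (a b : ℤ) :
    ∑ g : G, (a * orderOf g - b * (orderOf g).totient) =
      a * cyclicOrderSum (Nat.card G) - b * cyclicTotientSum (Nat.card G) := by
  simpa using sum_weight_mul_orderOf_of_isCyclic (G := G) (Nat.coprime_one_left _) a b

/-! ### Normal cyclic Sylow subgroup -/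

/-- The subgroup `⟨x⟩` has index below `p`, so it contains a Sylow `p`-subgroup and, being abelian,
normalizes it. The number of Sylow `p`-subgroups is then below `p` and congruent to 1 mod `p`. -/
theorem exists_normal_cyclic_sylow {G : Type*} [Group G] [Finite G] {p : ℕ} [hp : Fact p.Prime]
    {x : G} (hx : Nat.card G < p * orderOf x) :
    ∃ P : Sylow p G, (P : Subgroup G).Normal ∧ IsCyclic P := by
  set k := (Nat.card G).factorization p with hk
  have hdvd : p ^ k ∣ orderOf x := by
    obtain ⟨i, hi⟩ := orderOf_dvd_natCard x
    have hpos : 0 < i := Nat.pos_of_ne_zero fun h => Nat.card_pos.ne' (by rw [hi, h, mul_zero])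
    have hip : i < p := by
      rw [hi, mul_comm] at hx
      exact lt_of_mul_lt_mul_right hx (Nat.zero_le _)
    refine Nat.Coprime.dvd_of_dvd_mul_right (n := i) ?_ (hi ▸ Nat.ordProj_dvd _ _)
    exact Nat.Coprime.pow_left k ((Nat.Prime.coprime_iff_not_dvd hp.out).2
      (Nat.not_dvd_of_pos_of_lt hpos hip))
  have hox : orderOf x ≠ 0 := (orderOf_pos x).ne'
  obtain ⟨j, hj⟩ := hdvd
  have hj0 : j ≠ 0 := by rintro rfl; simp [hj] at hox
  have hcard : Nat.card (Subgroup.zpowers (x ^ j)) = p ^ k := by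
    rw [Nat.card_zpowers, orderOf_pow_of_dvd hj0 (hj ▸ Dvd.intro_left _ rfl), hj,
      Nat.mul_div_cancel _ (Nat.pos_of_ne_zero hj0)]
  let P : Sylow p G := Sylow.ofCard _ hcard
  have hP : (P : Subgroup G) = Subgroup.zpowers (x ^ j) := rfl
  refine ⟨P, ?_, by rw [hP]; infer_instance⟩
  have hle : Subgroup.zpowers x ≤ Subgroup.normalizer ((P : Subgroup G) : Set G) := by
    rw [Subgroup.zpowers_le, hP]
    refine Subgroup.mem_normalizer_iff.2 fun h => ?_
    have hx1 : ∀ i : ℤ, x * (x ^ j) ^ i * x⁻¹ = (x ^ j) ^ i := fun i => by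
      rw [(((Commute.refl x).pow_right j).zpow_right i).eq, mul_inv_cancel_right]
    constructor
    · rintro ⟨i, rfl⟩
      exact ⟨i, (hx1 i).symm⟩
    · rintro ⟨i, hi⟩
      refine ⟨i, ?_⟩
      change (x ^ j) ^ i = x * h * x⁻¹ at hi
      rw [← hx1 i] at hi
      simpa using hi
  have hlt : Nat.card (Sylow p G) < p := by
    rw [Sylow.card_eq_index_normalizer P]
    refine (Nat.le_of_dvd (Nat.pos_of_ne_zero Subgroup.index_ne_zero_of_finite)
      (Subgroup.index_dvd_of_le hle)).trans_lt ?_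
    have := Subgroup.card_mul_index (Subgroup.zpowers x)
    rw [Nat.card_zpowers] at this
    rw [← this, mul_comm] at hx
    exact lt_of_mul_lt_mul_right hx (Nat.zero_le _)
  have h1 : Nat.card (Sylow p G) = 1 := by
    have := card_sylow_modEq_one p G
    exact Nat.ModEq.eq_of_lt_of_lt this hlt hp.out.one_lt
  have : Subsingleton (Sylow p G) := (Nat.card_eq_one_iff_unique.1 h1).1
  exact Sylow.normal_of_subsingleton P

/-! ### Cosets of a normal cyclic `p`-subgroup -/

/-- In `s ^ m - 1 = (s - 1) * ∑ s ^ i`, the geometric sum is congruent to `m` mod `p`, hence prime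
to `p`. -/
theorem int_prime_pow_dvd_sub_one {p k m : ℕ} (hm : m.Coprime p) {s : ℤ}
    (h1 : (p : ℤ) ∣ s - 1) (h2 : (p ^ k : ℤ) ∣ s ^ m - 1) : (p ^ k : ℤ) ∣ s - 1 := by
  rw [← mul_geom_sum] at h2
  refine IsCoprime.dvd_of_dvd_mul_right (IsCoprime.pow_left ?_) h2
  have h3 : (p : ℤ) ∣ (∑ i ∈ Finset.range m, s ^ i) - m := by
    have : (∑ i ∈ Finset.range m, s ^ i) - (m : ℤ) = ∑ i ∈ Finset.range m, (s ^ i - 1) := by simp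
    rw [this]
    exact Finset.dvd_sum fun i _ => h1.trans (sub_one_dvd_pow_sub_one s i)
  obtain ⟨c, hc⟩ := h3
  have h4 : IsCoprime (p : ℤ) m := (Nat.isCoprime_iff_coprime.2 hm).symm
  have : (∑ i ∈ Finset.range m, s ^ i) = m + p * c := by linarith
  rw [this]
  exact h4.add_mul_left_right c

/-- Conjugation by `g` raises elements of `P` to some power `s`. As `g ^ m` lies in the abelian `P`,
`s ^ m ≡ 1` mod `p ^ k`; as `g` fixes `g ^ m ≠ 1`, `s ≡ 1` mod `p`. Together these force `s ≡ 1` mod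
`p ^ k`. -/
theorem commute_of_pow_mem_of_pow_ne_one {G : Type*} [Group G] [Finite G] {P : Subgroup G}
    [P.Normal] [IsCyclic P] {p k m : ℕ} (hp : p.Prime) (hP : Nat.card P = p ^ k)
    (hm : m.Coprime p) {g : G} (hg : g ^ m ∈ P) (hg1 : g ^ m ≠ 1) {u : G} (hu : u ∈ P) :
    Commute g u := by
  obtain ⟨z, rfl⟩ := (Subgroup.isCyclic_iff_exists_zpowers_eq_top P).1 inferInstance
  rw [Nat.card_zpowers] at hP
  have hz := Subgroup.mem_zpowers z
  obtain ⟨s, hs⟩ := Subgroup.mem_zpowers_iff.1 (Subgroup.Normal.conj_mem ‹_› z hz g)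
  obtain ⟨j, hj⟩ := Subgroup.mem_zpowers_iff.1 hg
  have hconj : ∀ i : ℤ, g * z ^ i * g⁻¹ = z ^ (s * i) := fun i => by
    rw [← conj_zpow, ← hs, zpow_mul]
  have hpow : ∀ i : ℕ, g ^ i * z * (g ^ i)⁻¹ = z ^ (s ^ i) := fun i => by
    induction i with
    | zero => simp
    | succ i ih =>
      calc g ^ (i + 1) * z * (g ^ (i + 1))⁻¹ = g * (g ^ i * z * (g ^ i)⁻¹) * g⁻¹ := by
            rw [pow_succ']; group
        _ = _ := by rw [ih, hconj, pow_succ']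
  have hdvd : ∀ {i l : ℤ}, z ^ i = z ^ l → (p ^ k : ℤ) ∣ i - l := fun {i l} h => by
    have : z ^ (i - l) = 1 := by rw [zpow_sub, h, mul_inv_cancel]
    have := orderOf_dvd_iff_zpow_eq_one.2 this
    rw [hP] at this
    exact_mod_cast this
  have h2 : (p ^ k : ℤ) ∣ s ^ m - 1 := by
    refine hdvd ?_
    rw [← hpow, ← hj, zpow_one]
    group
  have h1 : (p : ℤ) ∣ s - 1 := by
    have h3 : (p ^ k : ℤ) ∣ (s - 1) * j := by
      rw [sub_one_mul]
      refine hdvd ?_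
      rw [← hconj, hj]
      group
    by_contra hne
    have h4 : IsCoprime ((p : ℤ) ^ k) (s - 1) :=
      IsCoprime.pow_left ((Prime.coprime_iff_not_dvd (Nat.prime_iff_prime_int.1 hp)).2 hne)
    refine hg1 (hj ▸ orderOf_dvd_iff_zpow_eq_one.1 ?_)
    rw [hP]
    exact_mod_cast h4.dvd_of_dvd_mul_left h3
  have h3 := int_prime_pow_dvd_sub_one hm h1 h2
  have h4 : z ^ (s - 1) = 1 := orderOf_dvd_iff_zpow_eq_one.1 (by rw [hP]; exact_mod_cast h3)
  have h5 : Commute g z := by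
    have : z ^ s = z := by
      rw [zpow_sub, zpow_one, mul_inv_eq_one] at h4
      exact h4
    rw [this] at hs
    exact (mul_inv_eq_iff_eq_mul.1 hs.symm)
  obtain ⟨i, rfl⟩ := Subgroup.mem_zpowers_iff.1 hu
  exact h5.zpow_right i

theorem orderOf_eq_mul_orderOf_pow {G : Type*} [Group G] [Finite G] {P : Subgroup G} [P.Normal]
    (g : G) : orderOf g = orderOf (g : G ⧸ P) * orderOf (g ^ orderOf (g : G ⧸ P)) := by
  have h : orderOf (g : G ⧸ P) ∣ orderOf g := orderOf_map_dvd (QuotientGroup.mk' P) g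
  rw [orderOf_pow_of_dvd (orderOf_pos _).ne' h, Nat.mul_div_cancel' h]

/-- Let `P` be a normal cyclic `p`-subgroup and `c` a coset of order prime to `p`. Either `c`
centralizes `P` and its element orders are those of `P` scaled by `orderOf c`, or all elements of
`c` have order `orderOf c`. -/
theorem coset_order_dichotomy {G : Type*} [Group G] [Finite G] {P : Subgroup G}
    [P.Normal] [IsCyclic P] {p k : ℕ} (hp : p.Prime) (hP : Nat.card P = p ^ k)
    (c : G ⧸ P) (hc : (orderOf c).Coprime p) :
    (∃ e : {g : G // (g : G ⧸ P) = c} ≃ P, ∀ g : {g : G // (g : G ⧸ P) = c},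
      orderOf (g : G) = orderOf c * orderOf (e g)) ∨
      ∀ g : G, (g : G ⧸ P) = c → orderOf g = orderOf c := by
  have hmem : ∀ g : G, (g : G ⧸ P) = c → g ^ orderOf c ∈ P := fun g hg => by
    rw [← QuotientGroup.eq_one_iff, QuotientGroup.mk_pow, hg, pow_orderOf_eq_one]
  by_cases h : ∃ g : G, (g : G ⧸ P) = c ∧ g ^ orderOf c ≠ 1
  · left
    obtain ⟨g, hg, hg1⟩ := h
    have hcomm := fun u (hu : u ∈ P) =>
      commute_of_pow_mem_of_pow_ne_one hp hP hc (hmem g hg) hg1 hu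
    -- Since `g` centralizes `P`, `(g * u) ^ m = g ^ m * u ^ m` for `m = orderOf c`, and `u ↦ u ^ m`
    -- permutes `P` because `m` is prime to its order.
    let e : {g : G // (g : G ⧸ P) = c} → P := fun h => ⟨h ^ orderOf c, hmem h h.2⟩
    have hcop : (Nat.card P).Coprime (orderOf c) := by
      rw [hP]; exact (Nat.Coprime.pow_right k hc).symm
    have hsub : ∀ h : G, (h : G ⧸ P) = c → ∃ u : P, h = g * u := fun h hh =>
      ⟨⟨g⁻¹ * h, QuotientGroup.eq.1 (hg.trans hh.symm)⟩, by simp⟩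
    have hinj : Function.Injective e := by
      rintro ⟨x, hx⟩ ⟨y, hy⟩ hxy
      obtain ⟨u, rfl⟩ := hsub x hx
      obtain ⟨v, rfl⟩ := hsub y hy
      have h1 : (g * u) ^ orderOf c = (g * v) ^ orderOf c := congrArg Subtype.val hxy
      rw [(hcomm u u.2).mul_pow, (hcomm v v.2).mul_pow, mul_right_inj] at h1
      have h2 : u = v := (powCoprime hcop).injective (Subtype.ext (by simpa using h1))
      simp [h2]
    have hsurj : Function.Surjective e := by
      rintro u
      obtain ⟨v, hv⟩ := (powCoprime hcop).surjective (⟨g ^ orderOf c, hmem g hg⟩⁻¹ * u)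
      refine ⟨⟨g * v, by simpa [QuotientGroup.mk_mul] using hg⟩, Subtype.ext ?_⟩
      have hv' : (v : G) ^ orderOf c = (g ^ orderOf c)⁻¹ * u := by
        simpa using congrArg Subtype.val hv
      simp only [e]
      rw [(hcomm v v.2).mul_pow, hv', mul_inv_cancel_left]
    refine ⟨Equiv.ofBijective e ⟨hinj, hsurj⟩, ?_⟩
    rintro ⟨x, rfl⟩
    change orderOf x = _ * orderOf (e ⟨x, rfl⟩)
    rw [← Subgroup.orderOf_coe]
    exact orderOf_eq_mul_orderOf_pow x
  · right
    push Not at h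
    rintro g rfl
    conv_lhs => rw [orderOf_eq_mul_orderOf_pow (P := P) g, h g rfl]
    simp

/-! ### Counting edges of the power graph -/

theorem card_filter_zpowers_eq {G : Type*} [Group G] [Fintype G] [DecidableEq G] (g : G)
    [DecidablePred fun h => h ∈ Subgroup.zpowers g ∧ g ∈ Subgroup.zpowers h] :
    #{h | h ∈ Subgroup.zpowers g ∧ g ∈ Subgroup.zpowers h} = (orderOf g).totient := by
  classical
  rw [← IsCyclic.card_orderOf_eq_totient (α := Subgroup.zpowers g) (d := orderOf g)
    (by rw [Fintype.card_zpowers])]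
  refine (Finset.card_bij (fun (h : Subgroup.zpowers g) _ => (h : G)) ?_ (by simp) ?_).symm
  · rintro ⟨h, hh⟩ ho
    simp only [mem_filter, mem_univ, true_and, Subgroup.orderOf_mk] at ho ⊢
    refine ⟨hh, ?_⟩
    have : Subgroup.zpowers h = Subgroup.zpowers g :=
      Subgroup.eq_of_le_of_card_ge (Subgroup.zpowers_le.2 hh) 
        (by rw [Nat.card_zpowers, Nat.card_zpowers, ho])
    rw [this]
    exact Subgroup.mem_zpowers g
  · intro h hh
    simp only [mem_filter, mem_univ, true_and] at hh
    refine ⟨⟨h, hh.1⟩, ?_, rfl⟩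
    have : Subgroup.zpowers h = Subgroup.zpowers g :=
      le_antisymm (Subgroup.zpowers_le.2 hh.1) (Subgroup.zpowers_le.2 hh.2)
    simp only [mem_filter, mem_univ, true_and, Subgroup.orderOf_mk]
    rw [← Nat.card_zpowers, this, Nat.card_zpowers]

/-- Counting the arcs of the power graph, loops included, by their origin. -/
theorem two_mul_ncard_edgeSet_powerGraph (G : Type*) [Group G] [Fintype G] :
    2 * ((powerGraph G).edgeSet.ncard : ℤ) + Nat.card G =
      ∑ g : G, (2 * (orderOf g : ℤ) - 1 * (orderOf g).totient) := by
  classical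
  have h1 := (powerGraph G).sum_degrees_eq_twice_card_edges
  rw [← SimpleGraph.coe_edgeFinset, Set.ncard_coe_finset]
  -- Inclusion-exclusion on the closed neighbourhood of `g`; the overlap consists of the generators
  -- of `⟨g⟩`.
  have h2 : ∀ g : G, ((powerGraph G).degree g : ℤ) + 1 =
      orderOf g + #{h | g ∈ Subgroup.zpowers h} - (orderOf g).totient := fun g => by
    have h3 : (powerGraph G).degree g = #{h | (powerGraph G).Adj g h} := by
      rw [← SimpleGraph.card_neighborFinset_eq_degree, SimpleGraph.neighborFinset_eq_filter]
    have h4 : #{h | h ∈ Subgroup.zpowers g} = orderOf g := by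
      rw [← Fintype.card_zpowers, Fintype.card_subtype]
    have h5 : insert g ({h | (powerGraph G).Adj g h} : Finset G) =
        ({h | h ∈ Subgroup.zpowers g} : Finset G) ∪ ({h | g ∈ Subgroup.zpowers h} : Finset G) := by
      ext h
      simp only [powerGraph, mem_insert, mem_filter, mem_univ, true_and, mem_union]
      by_cases hgh : h = g
      · simp [hgh]
      · simp [hgh, eq_comm (a := g)]
    have h6 := Finset.card_union_add_card_inter
      ({h | h ∈ Subgroup.zpowers g} : Finset G) {h | g ∈ Subgroup.zpowers h}
    rw [← h5, card_insert_of_notMem (by simp), ← h3, h4, ← filter_and,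
      card_filter_zpowers_eq] at h6
    lia
  have h3 : ∑ g : G, (#{h | g ∈ Subgroup.zpowers h} : ℤ) = ∑ g : G, (orderOf g : ℤ) := by
    have : ∀ g : G, (orderOf g : ℤ) = #{h | h ∈ Subgroup.zpowers g} := fun g => by
      rw [← Fintype.card_zpowers, Fintype.card_subtype]
    simp_rw [this]
    exact_mod_cast Finset.sum_card_bipartiteAbove_eq_sum_card_bipartiteBelow
      (s := univ) (t := univ) (fun g h : G => g ∈ Subgroup.zpowers h)
  have h4 := Finset.sum_congr (s₁ := univ) rfl fun g (_ : g ∈ univ) => h2 g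
  rw [Finset.sum_add_distrib, ← Nat.cast_sum, h1, Finset.sum_sub_distrib, Finset.sum_add_distrib,
    h3] at h4
  rw [Finset.sum_sub_distrib, ← Finset.mul_sum]
  simp only [sum_const, card_univ, nsmul_eq_mul, one_mul, mul_one] at h4 ⊢
  rw [Nat.card_eq_fintype_card]
  push_cast at h4
  linarith

/-! ### Weights on cosets and the induction -/

theorem nonempty_fiber_mk_equiv {G : Type*} [Group G] (P : Subgroup G) (c : G ⧸ P) :
    Nonempty ({g : G // (g : G ⧸ P) = c} ≃ P) := by
  obtain ⟨g, rfl⟩ := QuotientGroup.mk_surjective c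
  exact ⟨{ toFun := fun h => ⟨g⁻¹ * h, QuotientGroup.eq.1 h.2.symm⟩
           invFun := fun u => ⟨g * u, by simp⟩
           left_inv := fun h => by simp
           right_inv := fun u => by simp }⟩

/-- The weight of `m` is positive, and `φ d ≤ d` makes the weight of `m * d` at least `d` times it.
-/
theorem weight_le_weight_mul {a b : ℤ} (hb : 0 < b) (hab : 2 * b ≤ a) {m d : ℕ} (hm : 0 < m)
    (hd : 0 < d) (h : m.Coprime d) :
    a * m - b * m.totient ≤ a * (m * d : ℕ) - b * (m * d).totient ∧
    (d ≠ 1 → a * m - b * m.totient < a * (m * d : ℕ) - b * (m * d).totient) := by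
  have h1 : (m.totient : ℤ) ≤ m := mod_cast m.totient_le
  have h2 : (d.totient : ℤ) ≤ d := mod_cast d.totient_le
  have hm' : (0 : ℤ) < m := mod_cast hm
  have hd' : (1 : ℤ) ≤ d := mod_cast hd
  have hF : 0 < a * m - b * m.totient := by
    have h3 : b * (m.totient : ℤ) ≤ b * m := by gcongr
    have h4 : 2 * b * (m : ℤ) ≤ a * m := by gcongr
    have h5 : 0 < b * (m : ℤ) := by positivity
    linarith
  have hmul : d * (a * m - b * m.totient) ≤ a * (m * d : ℕ) - b * (m * d).totient := by
    rw [Nat.totient_mul h]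
    push_cast
    have : b * m.totient * (d.totient : ℤ) ≤ b * m.totient * d := by gcongr
    linarith
  refine ⟨le_trans (le_mul_of_one_le_left hF.le hd') hmul, fun hne => lt_of_lt_of_le ?_ hmul⟩
  exact lt_mul_of_one_lt_left hF (mod_cast lt_of_le_of_ne hd (Ne.symm hne))

/-- The bound is the exact sum when the orders on `c` are `orderOf c` times those on `P`. In the
other case of the dichotomy the sum is strictly smaller, since `P` is nontrivial. -/
theorem sum_coset_weight {G : Type*} [Group G] [Fintype G] {P : Subgroup G} [P.Normal]
    [IsCyclic P] {p k : ℕ} (hp : p.Prime) (hk : k ≠ 0) (hP : Nat.card P = p ^ k)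
    {a b : ℤ} (hb : 0 < b) (hab : 2 * b ≤ a) (c : G ⧸ P) (hc : (orderOf c).Coprime p)
    [Fintype {g : G // (g : G ⧸ P) = c}] :
    ∑ g : {g : G // (g : G ⧸ P) = c},
        (a * orderOf (g : G) - b * (orderOf (g : G)).totient) ≤
      a * cyclicOrderSum (Nat.card P) * orderOf c -
        b * cyclicTotientSum (Nat.card P) * (orderOf c).totient ∧
    (∑ g : {g : G // (g : G ⧸ P) = c},
        (a * orderOf (g : G) - b * (orderOf (g : G)).totient) =
      a * cyclicOrderSum (Nat.card P) * orderOf c -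
        b * cyclicTotientSum (Nat.card P) * (orderOf c).totient →
      ∃ g : G, orderOf g = orderOf c * Nat.card P) := by
  classical
  have hcop : (orderOf c).Coprime (Nat.card P) := hP ▸ hc.pow_right k
  have := Fintype.ofFinite P
  rw [← sum_weight_mul_orderOf_of_isCyclic hcop]
  rcases coset_order_dichotomy hp hP c hc with ⟨e, he⟩ | h
  · refine ⟨le_of_eq ?_, fun _ => ?_⟩
    · rw [← Equiv.sum_comp e]
      exact Finset.sum_congr rfl fun g _ => by rw [he g]
    · obtain ⟨u, hu⟩ := IsCyclic.exists_ofOrder_eq_natCard (α := P)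
      exact ⟨(e.symm u : _), by rw [he, Equiv.apply_symm_apply, hu]⟩
  · obtain ⟨e⟩ := nonempty_fiber_mk_equiv P c
    have hlt : ∑ g : {g : G // (g : G ⧸ P) = c},
        (a * orderOf (g : G) - b * (orderOf (g : G)).totient) <
        ∑ u : P, (a * (orderOf c * orderOf u : ℕ) - b * (orderOf c * orderOf u).totient) := by
      rw [← Equiv.sum_comp e]
      have hw := fun u : P => weight_le_weight_mul hb hab (orderOf_pos c) (orderOf_pos u)
        (hcop.coprime_dvd_right (orderOf_dvd_natCard u))
      refine Finset.sum_lt_sum (fun g _ => ?_) ?_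
      · rw [h g g.2]
        exact (hw (e g)).1
      · have : Nontrivial P := Finite.one_lt_card_iff_nontrivial.1 (hP ▸ Nat.one_lt_pow hk hp.one_lt)
        obtain ⟨u, hu⟩ := exists_ne (1 : P)
        refine ⟨e.symm u, mem_univ _, ?_⟩
        rw [h _ (e.symm u).2, Equiv.apply_symm_apply]
        exact (hw u).2 (by simpa using hu)
    exact ⟨hlt.le, fun heq => absurd heq hlt.ne⟩

/-- If all orders were at most `n / p`, the sum would be below `a * n ^ 2 / p`. The cyclic value is
at least that: it is no less than `a / 2` times its value for weights 2 and 1, because `2 * b ≤ a`.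
-/
theorem exists_card_lt_mul_orderOf {G : Type*} [Group G] [Fintype G] {p : ℕ} (hp : 2 ≤ p)
    (hmax : ∀ q, q.Prime → q ∣ Nat.card G → q ≤ p) {a b : ℤ} (hb : 0 < b) (hab : 2 * b ≤ a)
    (h : a * cyclicOrderSum (Nat.card G) - b * cyclicTotientSum (Nat.card G) ≤
      ∑ g : G, (a * orderOf g - b * (orderOf g).totient)) :
    ∃ x : G, Nat.card G < p * orderOf x := by
  by_contra! hx
  have hn0 : Nat.card G ≠ 0 := Nat.card_pos.ne'
  have h1 := two_mul_sq_le_of_forall_prime_le hn0 hp hmax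
  have hterm : ∀ g : G, p * (a * orderOf g - b * (orderOf g).totient) < a * Nat.card G := fun g => by
    have h2 : (p : ℤ) * orderOf g ≤ Nat.card G := mod_cast hx g
    have h3 : 0 < (orderOf g).totient := Nat.totient_pos.2 (orderOf_pos g)
    have h4 : a * (p * orderOf g) ≤ a * Nat.card G := by gcongr; linarith
    have h5 : 0 < (p : ℤ) * (b * (orderOf g).totient) := by positivity
    linarith
  have hsum : p * ∑ g : G, (a * orderOf g - b * (orderOf g).totient) <
      a * (Nat.card G : ℤ) ^ 2 := by
    rw [Finset.mul_sum]
    refine (Finset.sum_lt_sum_of_nonempty univ_nonempty fun g _ => hterm g).trans_eq ?_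
    rw [sum_const, card_univ, ← Nat.card_eq_fintype_card, nsmul_eq_mul]
    ring
  have h2 : (p : ℤ) * (a * cyclicOrderSum (Nat.card G) - b * cyclicTotientSum (Nat.card G)) ≤
      p * ∑ g : G, (a * orderOf g - b * (orderOf g).totient) := by gcongr
  have h3 : a * (2 * (Nat.card G : ℤ) ^ 2) ≤
      a * (p * (2 * cyclicOrderSum (Nat.card G) - cyclicTotientSum (Nat.card G))) := by
    gcongr; linarith
  have h4 : 0 ≤ (a - 2 * b) * (p * (cyclicTotientSum (Nat.card G) : ℤ)) :=
    mul_nonneg (by linarith) (by positivity)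
  linarith

/-- Among the groups of order `n`, the sum of `a * orderOf g - b * φ (orderOf g)` with
`0 < 2 * b ≤ a` is maximal only for the cyclic group. -/
theorem isCyclic_of_weighted_sum_le (n : ℕ) : ∀ (G : Type*) [Group G] [Fintype G],
    Nat.card G = n → ∀ a b : ℤ, 0 < b → 2 * b ≤ a →
    a * cyclicOrderSum n - b * cyclicTotientSum n ≤
      ∑ g : G, (a * orderOf g - b * (orderOf g).totient) → IsCyclic G := by
  classical
  induction n using Nat.strong_induction_on with
  | _ n ih =>
  rintro G _ _ rfl a b hb hab h
  by_cases hone : Nat.card G = 1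
  · have := (Nat.card_eq_one_iff_unique.1 hone).1
    infer_instance
  have hn0 : Nat.card G ≠ 0 := Nat.card_pos.ne'
  obtain ⟨p, hpmem, hmax⟩ := (Nat.card G).primeFactors.exists_max_image id
    (Nat.nonempty_primeFactors.2 (by lia))
  have hp : p.Prime := Nat.prime_of_mem_primeFactors hpmem
  have hpn : p ∣ Nat.card G := Nat.dvd_of_mem_primeFactors hpmem
  have : Fact p.Prime := ⟨hp⟩
  obtain ⟨x, hx⟩ := exists_card_lt_mul_orderOf hp.two_le
    (fun q hq hqn => hmax q (Nat.mem_primeFactors.2 ⟨hq, hqn, hn0⟩)) hb hab h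
  obtain ⟨P, hN, hC⟩ := exists_normal_cyclic_sylow hx
  obtain ⟨k, hP⟩ := IsPGroup.iff_card.1 P.isPGroup'
  have hk : k ≠ 0 := by
    rintro rfl
    have := P.dvd_card_of_dvd_card hpn
    rw [hP, pow_zero] at this
    exact hp.one_lt.ne' (Nat.dvd_one.1 this)
  have hcard : Nat.card P * Nat.card (G ⧸ (P : Subgroup G)) = Nat.card G :=
    (P : Subgroup G).card_mul_index
  have hcop : (Nat.card (G ⧸ (P : Subgroup G))).Coprime p :=
    ((Nat.Prime.coprime_iff_not_dvd hp).2 P.not_dvd_index).symm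
  have hcop' : (Nat.card P).Coprime (Nat.card (G ⧸ (P : Subgroup G))) :=
    hP ▸ (hcop.pow_right k).symm
  have := Fintype.ofFinite (G ⧸ (P : Subgroup G))
  have hfib := fun c : G ⧸ (P : Subgroup G) => sum_coset_weight hp hk hP hb hab c
    (hcop.coprime_dvd_left (orderOf_dvd_natCard c))
  -- The weights for the quotient; `2 * B ≤ A` is inherited because the totient sum is at most the
  -- order sum.
  set A : ℤ := a * cyclicOrderSum (Nat.card P) with hA
  set B : ℤ := b * cyclicTotientSum (Nat.card P) with hB
  have hBpos : 0 < B := mul_pos hb (mod_cast cyclicTotientSum_pos Nat.card_pos.ne')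
  have hAB : 2 * B ≤ A := by
    have h1 : (cyclicTotientSum (Nat.card P) : ℤ) ≤ cyclicOrderSum (Nat.card P) :=
      mod_cast cyclicTotientSum_le _
    calc 2 * B = (2 * b) * cyclicTotientSum (Nat.card P) := by rw [hB]; ring
      _ ≤ a * cyclicOrderSum (Nat.card P) := by gcongr; linarith
  have hle : ∑ g : G, (a * orderOf g - b * (orderOf g).totient) ≤
      ∑ c : G ⧸ (P : Subgroup G), (A * orderOf c - B * (orderOf c).totient) := by
    rw [← Fintype.sum_fiberwise (fun g : G => (g : G ⧸ (P : Subgroup G)))]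
    exact Finset.sum_le_sum fun c _ => (hfib c).1
  have htarget : a * cyclicOrderSum (Nat.card G) - b * cyclicTotientSum (Nat.card G) =
      A * cyclicOrderSum (Nat.card (G ⧸ (P : Subgroup G))) -
        B * cyclicTotientSum (Nat.card (G ⧸ (P : Subgroup G))) := by
    rw [← hcard, cyclicOrderSum_mul hcop', cyclicTotientSum_mul hcop', hA, hB]
    push_cast
    ring
  have hlt : Nat.card (G ⧸ (P : Subgroup G)) < Nat.card G := by
    rw [← hcard]
    exact lt_mul_of_one_lt_left Nat.card_pos (hP ▸ Nat.one_lt_pow hk hp.one_lt)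
  have hQ : IsCyclic (G ⧸ (P : Subgroup G)) :=
    ih _ hlt _ rfl A B hBpos hAB (htarget ▸ h.trans hle)
  have hQsum : ∑ c : G ⧸ (P : Subgroup G), (A * orderOf c - B * (orderOf c).totient) =
      a * cyclicOrderSum (Nat.card G) - b * cyclicTotientSum (Nat.card G) := by
    rw [htarget, sum_orderOf_weight_of_isCyclic]
  have heq : ∑ g : G, (a * orderOf g - b * (orderOf g).totient) =
      ∑ c : G ⧸ (P : Subgroup G), (A * orderOf c - B * (orderOf c).totient) :=
    le_antisymm hle (hQsum.trans_le h)
  -- Equality of the totals forces equality on each coset, in particular on one generating `G ⧸ P`.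
  rw [← Fintype.sum_fiberwise (fun g : G => (g : G ⧸ (P : Subgroup G))),
    Finset.sum_eq_sum_iff_of_le fun c _ => (hfib c).1] at heq
  obtain ⟨c, hc⟩ := IsCyclic.exists_ofOrder_eq_natCard (α := G ⧸ (P : Subgroup G))
  obtain ⟨g, hg⟩ := (hfib c).2 (heq c (mem_univ c))
  exact isCyclic_of_orderOf_eq_card g (by rw [hg, hc, mul_comm, hcard])

theorem theorem1p3 (n : ℕ) (G : Type*) [Group G] [Finite G] (hn : Nat.card G = n) :
    (powerGraph G).edgeSet.ncard ≤ (powerGraph (Multiplicative (ZMod n))).edgeSet.ncard ∧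
      ((powerGraph G).edgeSet.ncard = (powerGraph (Multiplicative (ZMod n))).edgeSet.ncard ↔
        IsCyclic G) := by
  have := Fintype.ofFinite G
  have : NeZero n := ⟨hn ▸ Nat.card_pos.ne'⟩
  have hG := two_mul_ncard_edgeSet_powerGraph G
  have hZ := two_mul_ncard_edgeSet_powerGraph (Multiplicative (ZMod n))
  have hcard : Nat.card (Multiplicative (ZMod n)) = n := by simp
  rw [sum_orderOf_weight_of_isCyclic, hcard] at hZ
  rw [hn] at hG
  have hcyc : (powerGraph (Multiplicative (ZMod n))).edgeSet.ncard ≤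
      (powerGraph G).edgeSet.ncard → IsCyclic G := fun h =>
    isCyclic_of_weighted_sum_le n G hn 2 1 one_pos (by norm_num) (by lia)
  have heq : IsCyclic G → (powerGraph G).edgeSet.ncard =
      (powerGraph (Multiplicative (ZMod n))).edgeSet.ncard := fun _ => by
    rw [sum_orderOf_weight_of_isCyclic, hn] at hG
    lia
  refine ⟨?_, fun h => hcyc h.ge, heq⟩
  by_contra! h
  exact h.ne' (heq (hcyc h.le))
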